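/- Let $p>3$ be prime, let $\zeta_p=\exp(2\pi i/p)$, let $\mathbb{H}$ be the upper half-plane, and for $z\in\mathbb{H}$ write $q^{r}=\exp(2\pi i r z)$. Let $\eta(z)=q^{1/24}\prod_{n\ge1}(1-q^n)$ be the Dedekind eta function, and for an integer $\ell$ with $1\le\ell\le p-1$ put $$E_{0,\ell}(z)=q^{1/12}\prod_{m=1}^{\infty}\bigl(1-\zeta_p^{\ell}q^{m-1}\bigr)\bigl(1-\zeta_p^{-\ell}q^{m}\bigr),\qquad F_1(\ell;z)=\frac{\eta(z)^2}{E_{0,\ell}(z)}.$$ For $f:\mathbb{H}\to\mathbb{C}$ and $A=\begin{pmatrix}a&b\\c&d\end{pmatrix}\in\mathrm{SL}_2(\mathbb{Z})$ let $(f|A)(z)=(cz+d)^{-1}f\!\left(\frac{az+b}{cz+d}\right)$ be the weight-$1$ slash operator, and let $\overline{m}$ denote the least nonnegative residue of $m$ modulo $p$. Then for every $1\le\ell\le p-1$: 1. For every $A=\begin{pmatrix}a&b\\c&d\end{pmatrix}\in\Gamma_0(p)$, $$F_1(\ell;\cdot)\,|\,A=\mu(A,\ell)\,F_1(\overline{d\ell};\cdot),\qquad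 \mu(A,\ell)=\exp\!\left(\pi i\left(\frac{\ell(d-1)}{p}+\frac{cd\ell^2}{p^2}-\frac{c\ell}{p}\right)\right).$$ 2. Consequently, $F_1(\ell;\cdot)\,|\,A=F_1(\ell;\cdot)$ for every $A\in\Gamma_0(p^2)\cap\Gamma_1(p)$. -/

import Mathlib

namespace CrankForm

/-- The root of unity `ζ_p = exp(2πi/p)`. -/
noncomputable def zeta (p : ℕ) : ℂ := Complex.exp (2 * Real.pi * Complex.I / p)

/-- `q = exp(2πiz)`. -/
noncomputable def nome (z : UpperHalfPlane) : ℂ :=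
  Complex.exp (2 * Real.pi * Complex.I * z)

/-- The generalized eta function
`E_{0,ℓ}(z) = q^{1/12} ∏_{m ≥ 1} (1 - ζ_p^ℓ q^{m-1}) (1 - ζ_p^{-ℓ} q^m)`, where
`q^{1/12} = exp(2πiz/12)`; the product below is indexed by `n = m - 1 ≥ 0`. -/
noncomputable def E0 (p : ℕ) (l : ℤ) (z : UpperHalfPlane) : ℂ :=
  Complex.exp (2 * Real.pi * Complex.I * z / 12) *
    ∏' n : ℕ, ((1 - zeta p ^ l * nome z ^ n) * (1 - zeta p ^ (-l) * nome z ^ (n + 1)))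

/-- `F_1(ℓ; z) = η(z)² / E_{0,ℓ}(z)`, with `η` the Dedekind eta function. -/
noncomputable def F1 (p : ℕ) (l : ℤ) : UpperHalfPlane → ℂ :=
  fun z => ModularForm.eta (z : ℂ) ^ 2 / E0 p l z

/-- The multiplier
`μ(A, ℓ) = exp(πi (ℓ(d-1)/p + c d ℓ²/p² - c ℓ/p))` for `A = (a b; c d)`. -/
noncomputable def mu (p : ℕ) (A : Matrix.SpecialLinearGroup (Fin 2) ℤ) (l : ℤ) : ℂ :=
  Complex.exp (Real.pi * Complex.I *
    ((l : ℂ) * ((A 1 1 : ℂ) - 1) / (p : ℂ)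
      + (A 1 0 : ℂ) * (A 1 1 : ℂ) * (l : ℂ) ^ 2 / (p : ℂ) ^ 2
      - (A 1 0 : ℂ) * (l : ℂ) / (p : ℂ)))

end CrankForm

open scoped ModularForm

open scoped Topology
open Filter Complex
open UpperHalfPlane hiding I

namespace CrankForm

/-! Write θ for `oddTheta τ`. The powers q^{1/12} cancel in F_1, and θ'(0) = -2πi (q;q)_∞², so up to
a constant F_1(ℓ;τ) is θ'(0)/θ(ℓ/p) (`F1_eq`, `hasDerivAt_oddTheta_zero`). For A = (a b; c d) and j
= cτ + d, the functions exp(-πi c u²/j) θ_{Aτ}(u/j) and θ_τ(u) have the same multipliers under u ↦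
u+1 and u ↦ u+τ. The zeros of θ_τ are simple and lie in ℤ + ℤτ, where the first function vanishes
too, so the quotient is entire and elliptic, hence constant. Derivatives at 0 give the constant
(`oddTheta_smul`). At u = (ℓ/p)j with p ∣ c, u is dℓ/p plus the lattice vector (cℓ/p)τ;
quasi-periodicity then produces μ (`F1_slash`). On Γ₀(p²) ∩ Γ₁(p) the exponent of μ is πi times an
even integer (`mu_eq_one`). -/

/-- The infinite `q`-Pochhammer symbol `(w; q)_∞ = ∏_{n ≥ 0} (1 - w qⁿ)`. -/
noncomputable def qPoch (q w : ℂ) : ℂ := ∏' n : ℕ, (1 - w * q ^ n)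

lemma summable_norm_mul_pow {q : ℂ} (hq : ‖q‖ < 1) (w : ℂ) :
    Summable fun n : ℕ ↦ ‖-(w * q ^ n)‖ := by
  simpa using (summable_geometric_of_lt_one (norm_nonneg _) hq).mul_left ‖w‖

lemma multipliable_qPoch {q : ℂ} (hq : ‖q‖ < 1) (w : ℂ) :
    Multipliable fun n : ℕ ↦ 1 - w * q ^ n := by
  simpa only [← sub_eq_add_neg] using
    multipliable_one_add_of_summable (summable_norm_mul_pow hq w)

lemma qPoch_eq {q : ℂ} (hq : ‖q‖ < 1) (w : ℂ) :
    qPoch q w = (1 - w) * qPoch q (w * q) := by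
  have h : (fun n : ℕ ↦ 1 - w * q ^ (n + 1)) = fun n : ℕ ↦ 1 - w * q * q ^ n := by
    ext n; ring
  have := tprod_eq_zero_mul' (f := fun n : ℕ ↦ 1 - w * q ^ n) (h ▸ multipliable_qPoch hq (w * q))
  rw [h] at this
  simpa [qPoch] using this

/-- An absolutely convergent product vanishes only if one of its factors does. -/
lemma exists_of_qPoch_eq_zero {q : ℂ} (hq : ‖q‖ < 1) {w : ℂ} (h : qPoch q w = 0) :
    ∃ n : ℕ, w * q ^ n = 1 := by
  by_contra! hn
  refine tprod_one_add_ne_zero_of_summable (f := fun n : ℕ ↦ -(w * q ^ n)) (fun n h0 ↦ hn n ?_)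
    (summable_norm_mul_pow hq w) (by simpa only [qPoch, sub_eq_add_neg] using h)
  linear_combination -h0

lemma differentiable_qPoch {q : ℂ} (hq : ‖q‖ < 1) : Differentiable ℂ (qPoch q) := by
  intro w
  have hu : Summable fun n : ℕ ↦ (‖w‖ + 1) * ‖q‖ ^ n :=
    (summable_geometric_of_lt_one (norm_nonneg _) hq).mul_left _
  have key := Summable.hasProdLocallyUniformlyOn_nat_one_add
    (f := fun (n : ℕ) (x : ℂ) ↦ -(x * q ^ n)) (Metric.isOpen_ball (x := (0 : ℂ)) (ε := ‖w‖ + 1)) hu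
    (.of_forall fun n x hx ↦ by
      rw [norm_neg, norm_mul, norm_pow]
      gcongr
      simpa using (Metric.mem_ball.1 hx).le) (fun n ↦ by fun_prop)
  have := key.differentiableOn (.of_forall fun _ ↦ by
    simpa [Finset.prod_fn] using DifferentiableOn.finsetProd (fun _ _ ↦ by fun_prop))
    Metric.isOpen_ball
  simp only [← sub_eq_add_neg] at this
  exact this.differentiableAt (Metric.isOpen_ball.mem_nhds (by simp))

lemma norm_nome_lt_one (τ : ℍ) : ‖nome τ‖ < 1 := norm_exp_two_pi_I_lt_one τ

/-! ### The odd theta function: quasi-periodicity, zeros, derivative at 0 -/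

/-- The function `x^{-1/2} (x; q)_∞ (q / x; q)_∞` of `x = exp(2πiu)`, `q = exp(2πiτ)`; up to a
factor depending on `τ` only, it is the odd Jacobi theta function. -/
noncomputable def oddTheta (τ : ℍ) (u : ℂ) : ℂ :=
  cexp (-(Real.pi * I * u)) * (qPoch (nome τ) (cexp (2 * Real.pi * I * u)) *
    qPoch (nome τ) (nome τ * cexp (-(2 * Real.pi * I * u))))

lemma differentiable_oddTheta (τ : ℍ) : Differentiable ℂ (oddTheta τ) := by
  have h := differentiable_qPoch (norm_nome_lt_one τ)
  unfold oddTheta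
  have h1 : Differentiable ℂ fun u : ℂ ↦ qPoch (nome τ) (cexp (2 * Real.pi * I * u)) :=
    h.comp (by fun_prop)
  have h2 : Differentiable ℂ fun u : ℂ ↦
      qPoch (nome τ) (nome τ * cexp (-(2 * Real.pi * I * u))) :=
    h.comp (g := qPoch (nome τ)) (by fun_prop)
  fun_prop

lemma oddTheta_add_one (τ : ℍ) (u : ℂ) :
    oddTheta τ (u + 1) = cexp (Real.pi * I) * oddTheta τ u := by
  have h1 : cexp (2 * Real.pi * I * (u + 1)) = cexp (2 * Real.pi * I * u) := by
    rw [mul_add, Complex.exp_add, mul_one, Complex.exp_two_pi_mul_I, mul_one]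
  have h2 : cexp (-(Real.pi * I * (u + 1))) = cexp (Real.pi * I) * cexp (-(Real.pi * I * u)) := by
    rw [← Complex.exp_add, Complex.exp_eq_exp_iff_exists_int]
    exact ⟨-1, by push_cast; ring⟩
  rw [oddTheta, oddTheta, h2, Complex.exp_neg (2 * _ * _ * _), h1, Complex.exp_neg (2 * _ * _ * _)]
  ring

/-- The shift replaces x = exp(2πiu) by xq: one product loses the factor 1 - x, the other gains 1 -
1/x, and their ratio is -1/x. -/
lemma oddTheta_add_coe (τ : ℍ) (u : ℂ) :
    oddTheta τ (u + τ) =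
      cexp (Real.pi * I - Real.pi * I * τ - 2 * Real.pi * I * u) * oddTheta τ u := by
  have hq := norm_nome_lt_one τ
  have h1 : cexp (2 * Real.pi * I * (u + τ)) = cexp (2 * Real.pi * I * u) * nome τ := by
    rw [mul_add, Complex.exp_add, nome]
  have h2 : nome τ * cexp (-(2 * Real.pi * I * (u + τ))) = cexp (-(2 * Real.pi * I * u)) := by
    rw [nome, ← Complex.exp_add]; congr 1; ring
  have h3 : cexp (-(Real.pi * I * (u + τ))) =
      cexp (-(Real.pi * I * τ)) * cexp (-(Real.pi * I * u)) := by
    rw [← Complex.exp_add]; congr 1; ring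
  have h4 : cexp (Real.pi * I - Real.pi * I * τ - 2 * Real.pi * I * u) =
      -(cexp (-(Real.pi * I * τ)) * cexp (-(2 * Real.pi * I * u))) := by
    rw [← Complex.exp_add, sub_sub, sub_eq_add_neg, Complex.exp_add, Complex.exp_pi_mul_I, neg_add]
    ring
  have h5 : cexp (-(2 * Real.pi * I * u)) * cexp (2 * Real.pi * I * u) = 1 := by
    rw [← Complex.exp_add]; simp
  rw [oddTheta, oddTheta, h1, h2, h3, h4, qPoch_eq hq (cexp (2 * Real.pi * I * u)),
    qPoch_eq hq (cexp (-(2 * Real.pi * I * u))), mul_comm (nome τ)]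
  linear_combination (-cexp (-(Real.pi * I * τ)) * cexp (-(Real.pi * I * u)) *
    qPoch (nome τ) (cexp (2 * Real.pi * I * u) * nome τ) *
    qPoch (nome τ) (cexp (-(2 * Real.pi * I * u)) * nome τ)) * h5

lemma oddTheta_add_int_mul (τ : ℍ) (u : ℂ) (m : ℤ) :
    oddTheta τ (u + m * τ) =
      cexp (Real.pi * I * m - Real.pi * I * m ^ 2 * τ - 2 * Real.pi * I * m * u) *
        oddTheta τ u := by
  induction m with
  | zero => simp
  | succ n ih =>
    rw [show u + ((n + 1 : ℤ) : ℂ) * τ = u + (n : ℤ) * τ + τ by push_cast; ring,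
      oddTheta_add_coe, ih, ← mul_assoc, ← Complex.exp_add]
    congr 2
    push_cast; ring
  | pred n ih =>
    have h := oddTheta_add_coe τ (u + ((-n - 1 : ℤ) : ℂ) * τ)
    rw [show u + ((-n - 1 : ℤ) : ℂ) * τ + τ = u + (-n : ℤ) * τ by push_cast; ring, ih] at h
    rw [← mul_right_inj' (Complex.exp_ne_zero _), ← h, ← mul_assoc, ← Complex.exp_add]
    congr 2
    push_cast; ring

lemma oddTheta_add_int (τ : ℍ) (u : ℂ) (n : ℤ) :
    oddTheta τ (u + n) = cexp (Real.pi * I * n) * oddTheta τ u := by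
  induction n with
  | zero => simp
  | succ n ih =>
    rw [show u + ((n + 1 : ℤ) : ℂ) = u + (n : ℤ) + 1 by push_cast; ring,
      oddTheta_add_one, ih, ← mul_assoc, ← Complex.exp_add]
    congr 2
    push_cast; ring
  | pred n ih =>
    have h := oddTheta_add_one τ (u + ((-n - 1 : ℤ) : ℂ))
    rw [show u + ((-n - 1 : ℤ) : ℂ) + 1 = u + (-n : ℤ) by push_cast; ring, ih] at h
    rw [← mul_right_inj' (Complex.exp_ne_zero (Real.pi * I)), ← h, ← mul_assoc, ← Complex.exp_add]
    congr 2
    push_cast; ring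

lemma oddTheta_add_lattice (τ : ℍ) (u : ℂ) (m n : ℤ) :
    oddTheta τ (u + (m * τ + n)) =
      cexp (Real.pi * I * (m + n) - Real.pi * I * m ^ 2 * τ - 2 * Real.pi * I * m * u) *
        oddTheta τ u := by
  rw [← add_assoc, oddTheta_add_int, oddTheta_add_int_mul, ← mul_assoc, ← Complex.exp_add]
  congr 2
  ring

lemma exists_of_oddTheta_eq_zero {τ : ℍ} {u : ℂ} (h : oddTheta τ u = 0) :
    ∃ m n : ℤ, u = m * τ + n := by
  have hq := norm_nome_lt_one τ
  have hpi : (2 * Real.pi * I : ℂ) ≠ 0 := Complex.two_pi_I_ne_zero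
  rw [oddTheta, mul_eq_zero, mul_eq_zero] at h
  obtain h | h | h := h
  · exact absurd h (Complex.exp_ne_zero _)
  · obtain ⟨n, hn⟩ := exists_of_qPoch_eq_zero hq h
    rw [nome, ← Complex.exp_nat_mul, ← Complex.exp_add, Complex.exp_eq_one_iff] at hn
    obtain ⟨k, hk⟩ := hn
    refine ⟨-n, k, mul_left_cancel₀ hpi ?_⟩
    push_cast
    linear_combination hk
  · obtain ⟨n, hn⟩ := exists_of_qPoch_eq_zero hq h
    rw [nome, ← Complex.exp_nat_mul, ← Complex.exp_add, ← Complex.exp_add,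
      Complex.exp_eq_one_iff] at hn
    obtain ⟨k, hk⟩ := hn
    refine ⟨n + 1, -k, mul_left_cancel₀ hpi ?_⟩
    push_cast
    linear_combination -hk

lemma oddTheta_zero (τ : ℍ) : oddTheta τ 0 = 0 := by
  simp [oddTheta, qPoch_eq (norm_nome_lt_one τ) 1]

lemma qPoch_nome_ne_zero (τ : ℍ) : qPoch (nome τ) (nome τ) ≠ 0 := by
  intro h
  obtain ⟨n, hn⟩ := exists_of_qPoch_eq_zero (norm_nome_lt_one τ) h
  have : ‖nome τ ^ (n + 1)‖ < 1 := by
    rw [norm_pow]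
    exact pow_lt_one₀ (norm_nonneg _) (norm_nome_lt_one τ) (by simp)
  rw [pow_succ', hn] at this
  simp at this

/-- Only the factor 1 - x vanishes at u = 0; the remaining factors equal (q;q)_∞² there. -/
lemma hasDerivAt_oddTheta_zero (τ : ℍ) :
    HasDerivAt (oddTheta τ) (-(2 * Real.pi * I) * qPoch (nome τ) (nome τ) ^ 2) 0 := by
  have hq := norm_nome_lt_one τ
  have hd := differentiable_qPoch hq
  have hfac : oddTheta τ = fun u ↦ (1 - cexp (2 * Real.pi * I * u)) *
      (cexp (-(Real.pi * I * u)) * (qPoch (nome τ) (cexp (2 * Real.pi * I * u) * nome τ) *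
        qPoch (nome τ) (nome τ * cexp (-(2 * Real.pi * I * u))))) := by
    ext u
    rw [oddTheta, qPoch_eq hq (cexp (2 * Real.pi * I * u))]
    ring
  have h1 : HasDerivAt (fun u : ℂ ↦ 1 - cexp (2 * Real.pi * I * u)) (-(2 * Real.pi * I)) 0 := by
    have := (((hasDerivAt_id (0 : ℂ)).const_mul (2 * Real.pi * I)).cexp).const_sub 1
    simpa using this
  have h2 : Differentiable ℂ fun u : ℂ ↦
      qPoch (nome τ) (cexp (2 * Real.pi * I * u) * nome τ) :=
    hd.comp (g := qPoch (nome τ)) (by fun_prop)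
  have h3 : Differentiable ℂ fun u : ℂ ↦
      qPoch (nome τ) (nome τ * cexp (-(2 * Real.pi * I * u))) :=
    hd.comp (g := qPoch (nome τ)) (by fun_prop)
  have h4 : Differentiable ℂ fun u : ℂ ↦
      cexp (-(Real.pi * I * u)) * (qPoch (nome τ) (cexp (2 * Real.pi * I * u) * nome τ) *
        qPoch (nome τ) (nome τ * cexp (-(2 * Real.pi * I * u)))) := by fun_prop
  rw [hfac]
  refine (h1.fun_mul (h4 0).hasDerivAt).congr_deriv ?_
  simp [sq]

/-! ### Liouville's theorem and comparison of quasi-periodic functions -/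

/-- Liouville's theorem for elliptic functions. -/
lemma eq_const_of_doubly_periodic {R : ℂ → ℂ} (hR : Differentiable ℂ R) (τ : ℍ)
    (h1 : Function.Periodic R 1) (hτ : Function.Periodic R τ) (u v : ℂ) : R u = R v := by
  refine hR.apply_eq_apply_of_bounded ?_ u v
  have hK : IsCompact (Set.Icc (0 : ℝ) 1 ×ℂ Set.Icc 0 τ.im) := isCompact_Icc.reProdIm isCompact_Icc
  refine (hK.image hR.continuous).isBounded.subset ?_
  rintro _ ⟨w, rfl⟩
  have hy := τ.im_pos
  -- Translating by a multiple of τ fixes the imaginary part, and an integer translation then fixes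
  -- the real part, so a rectangle suffices.
  set n : ℤ := ⌊w.im / τ.im⌋
  set w' : ℂ := w - n * τ with hw'
  have h2 : (n : ℝ) ≤ w.im / τ.im := Int.floor_le _
  have h3 : w.im / τ.im < n + 1 := Int.lt_floor_add_one _
  rw [le_div_iff₀ hy] at h2
  rw [div_lt_iff₀ hy] at h3
  refine ⟨w' - ⌊w'.re⌋, ?_, ?_⟩
  · rw [mem_reProdIm]
    have h4 := Int.floor_le w'.re
    have h5 := Int.lt_floor_add_one w'.re
    have h6 : w'.im = w.im - n * τ.im := by simp [hw']
    have h7 : (w' - ⌊w'.re⌋).re = w'.re - ⌊w'.re⌋ := by simp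
    have h8 : (w' - ⌊w'.re⌋).im = w'.im := by simp
    rw [h7, h8, h6]
    refine ⟨⟨?_, ?_⟩, ⟨?_, ?_⟩⟩ <;> linarith
  · have := h1.sub_int_mul_eq (x := w') ⌊w'.re⌋
    rw [mul_one] at this
    rw [this, hw', hτ.sub_int_mul_eq]

/-- Two entire functions with the same multipliers along the lattice `ℤ + ℤτ` are proportional if
the second one has simple zeros, all in the lattice, and the first one vanishes at `0`. -/
lemma eq_div_mul_of_quasiPeriodic {f g : ℂ → ℂ} (τ : ℍ) (hf : Differentiable ℂ f)
    (hg : Differentiable ℂ g) {m₁ m₂ : ℂ → ℂ} (hm₁ : ∀ u, m₁ u ≠ 0) (hm₂ : ∀ u, m₂ u ≠ 0)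
    (hf₁ : ∀ u, f (u + 1) = m₁ u * f u) (hg₁ : ∀ u, g (u + 1) = m₁ u * g u)
    (hf₂ : ∀ u, f (u + τ) = m₂ u * f u) (hg₂ : ∀ u, g (u + τ) = m₂ u * g u)
    (hzero : ∀ u, g u = 0 → ∃ m n : ℤ, u = m * τ + n) (hf0 : f 0 = 0) (hg0 : g 0 = 0)
    {f' g' : ℂ} (hf' : HasDerivAt f f' 0) (hg' : HasDerivAt g g' 0) (hg'0 : g' ≠ 0)
    {u : ℂ} (hu : g u ≠ 0) : f u = f' / g' * g u := by
  classical
  -- The value at the zeros of g is the limit of f/g at 0, so it removes the singularity there and,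
  -- by periodicity, at every lattice point.
  set R : ℂ → ℂ := fun v ↦ if g v = 0 then f' / g' else f v / g v with hR
  have hper : ∀ {w : ℂ} {m : ℂ → ℂ}, (∀ v, m v ≠ 0) → (∀ v, f (v + w) = m v * f v) →
      (∀ v, g (v + w) = m v * g v) → Function.Periodic R w := by
    intro w m hm hfw hgw v
    simp only [hR, hfw, hgw, mul_eq_zero, hm, false_or]
    rw [mul_div_mul_left _ _ (hm v)]
  have h1 : Function.Periodic R 1 := hper hm₁ hf₁ hg₁
  have hτ : Function.Periodic R τ := hper hm₂ hf₂ hg₂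
  have hdiff : ∀ v, g v ≠ 0 → DifferentiableAt ℂ R v := by
    intro v hv
    refine ((hf v).div (hg v) hv).congr_of_eventuallyEq ?_
    filter_upwards [(hg v).continuousAt.eventually_ne hv] with w hw
    simp [hR, hw]
  have hne : ∀ᶠ v in 𝓝[≠] (0 : ℂ), g v ≠ 0 := by
    simpa [hg0] using hg'.eventually_ne hg'0 (c := 0)
  have hcont : ContinuousAt R 0 := by
    rw [continuousAt_iff_punctured_nhds]
    have h := (hasDerivAt_iff_tendsto_slope.1 hf').div (hasDerivAt_iff_tendsto_slope.1 hg') hg'0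
    have hR0 : R 0 = f' / g' := by simp [hR, hg0]
    rw [hR0]
    refine h.congr' ?_
    filter_upwards [hne, self_mem_nhdsWithin] with v hv hv0
    have hv0 : v ≠ 0 := hv0
    simp only [Pi.div_apply, slope_def_field, hf0, hg0, sub_zero, hR, hv, if_false]
    rw [div_div_div_cancel_right₀ hv0]
  have hdiff0 : DifferentiableAt ℂ R 0 :=
    (analyticAt_of_differentiable_on_punctured_nhds_of_continuousAt
      (hne.mono hdiff) hcont).differentiableAt
  have hRd : Differentiable ℂ R := by
    intro v
    by_cases hv : g v = 0
    · obtain ⟨m, n, hmn⟩ := hzero v hv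
      have hshift : R = fun w ↦ R (w - v) := by
        ext w
        have e2 := h1.sub_int_mul_eq (x := w - m * τ) n
        rw [mul_one] at e2
        rw [hmn, ← sub_sub, e2, hτ.sub_int_mul_eq]
      rw [hshift]
      have : DifferentiableAt ℂ R (v - v) := by rwa [sub_self]
      exact DifferentiableAt.comp (g := R) v this (by fun_prop)
    · exact hdiff v hv
  have := eq_const_of_doubly_periodic hRd τ h1 hτ u 0
  simp only [hR, hu, hg0, if_true, if_false] at this
  rwa [div_eq_iff hu] at this

/-! ### Modular transformation of the odd theta function -/

lemma exp_pi_mul_I_mul_int_congr {m n : ℤ} (h : Even (m - n)) :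
    cexp (Real.pi * I * m) = cexp (Real.pi * I * n) := by
  obtain ⟨k, hk⟩ := h
  rw [Complex.exp_eq_exp_iff_exists_int]
  refine ⟨k, ?_⟩
  have : (m : ℂ) = n + (k + k) := by
    rw [← Int.cast_add, ← hk]; push_cast; ring
  rw [this]; ring

lemma odd_add_add_mul_of_not_even {a c : ℤ} (h : ¬ (Even a ∧ Even c)) :
    Odd (a + c + a * c) := by
  rw [← Int.not_even_iff_odd]
  simp only [Int.even_add, Int.even_mul]
  tauto

/-- Modular transformation of the odd theta function: it behaves as a Jacobi form of weight `-1`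
and index `1/2` after division by its derivative at the origin. -/
lemma oddTheta_smul (A : Matrix.SpecialLinearGroup (Fin 2) ℤ) (τ : ℍ) {u : ℂ}
    (hu : oddTheta τ u ≠ 0) :
    cexp (-(Real.pi * I * (A 1 0) * u ^ 2 / (A 1 0 * τ + A 1 1))) *
        oddTheta (A • τ) (u / (A 1 0 * τ + A 1 1)) =
      qPoch (nome (A • τ)) (nome (A • τ)) ^ 2 /
        ((A 1 0 * τ + A 1 1) * qPoch (nome τ) (nome τ) ^ 2) * oddTheta τ u := by
  have hj : (A 1 0 * τ + A 1 1 : ℂ) ≠ 0 := by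
    simpa [ModularGroup.denom_apply] using denom_ne_zero A τ
  have hA : ((A • τ : ℍ) : ℂ) = (A 0 0 * τ + A 0 1) / (A 1 0 * τ + A 1 1) := by
    rw [coe_specialLinearGroup_apply]; simp
  have hdetZ : A 0 0 * A 1 1 - A 0 1 * A 1 0 = 1 := by
    rw [← Matrix.det_fin_two]; exact A.det_coe
  generalize A • τ = σ at hA ⊢
  generalize A 0 0 = a, A 0 1 = b, A 1 0 = c, A 1 1 = d at *
  have hdet : (a * d - b * c : ℂ) = 1 := by exact_mod_cast hdetZ
  set j : ℂ := c * τ + d with hjdef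
  have hσ : σ * j = a * τ + b := by rw [hA, div_mul_cancel₀ _ hj]
  -- Dividing the periods 1 and τ by j gives lattice vectors for σ, so the quasi-periodicity of θ_σ
  -- applies.
  have h1j : 1 / j = a - c * σ := by
    rw [div_eq_iff hj]; linear_combination (c : ℂ) * hσ - a * hjdef - hdet
  have hτj : τ / j = d * σ - b := by
    rw [div_eq_iff hj]; linear_combination (-d : ℂ) * hσ + b * hjdef - τ * hdet
  set f : ℂ → ℂ := fun u ↦ cexp (-(Real.pi * I * c * u ^ 2 / j)) * oddTheta σ (u / j) with hf
  have hθ := differentiable_oddTheta σ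
  have hcomp : Differentiable ℂ fun u : ℂ ↦ oddTheta σ (u / j) :=
    hθ.comp (g := oddTheta σ) (by fun_prop)
  have hfd : Differentiable ℂ f := by fun_prop
  -- Under v ↦ v+1 the Gaussian factor cancels all dependence on v and leaves the sign
  -- (-1)^(a-c-ac). It is -1 because determinant 1 forbids a and c both even; b and d play this role
  -- for the shift by τ.
  have hodd₁ : Even (a - c - a * c - 1) := by
    have : ¬ (Even a ∧ Even c) := by
      rintro ⟨⟨x, rfl⟩, ⟨y, rfl⟩⟩
      have : 2 * (x * d - b * y) = 1 := by linear_combination hdetZ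
      omega
    have := odd_add_add_mul_of_not_even this
    rw [← Int.not_even_iff_odd] at this
    simp only [Int.even_sub, Int.even_add, Int.not_even_one] at this ⊢
    tauto
  have hodd₂ : Even (d - b - b * d - 1) := by
    have : ¬ (Even b ∧ Even d) := by
      rintro ⟨⟨x, rfl⟩, ⟨y, rfl⟩⟩
      have : 2 * (a * y - x * c) = 1 := by linear_combination hdetZ
      omega
    have := odd_add_add_mul_of_not_even this
    rw [← Int.not_even_iff_odd] at this
    simp only [Int.even_sub, Int.even_add, Int.not_even_one] at this ⊢
    tauto
  have hf₁ : ∀ v, f (v + 1) = cexp (Real.pi * I) * f v := by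
    intro v
    have e1 : (v + 1) / j = v / j + ((-c : ℤ) * σ + (a : ℤ)) := by
      rw [add_div, h1j]; push_cast; ring
    have e2 := exp_pi_mul_I_mul_int_congr hodd₁
    rw [Int.cast_one, mul_one] at e2
    simp only [hf]
    rw [e1, oddTheta_add_lattice, ← e2, ← mul_assoc, ← mul_assoc, ← Complex.exp_add,
      ← Complex.exp_add]
    congr 2
    push_cast
    linear_combination (-(Real.pi * I * c) : ℂ) * h1j
  have hf₂ : ∀ v, f (v + τ) =
      cexp (Real.pi * I - Real.pi * I * τ - 2 * Real.pi * I * v) * f v := by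
    intro v
    have e1 : (v + τ) / j = v / j + ((d : ℤ) * σ + (-b : ℤ)) := by
      rw [add_div, hτj]; push_cast; ring
    have e2 := exp_pi_mul_I_mul_int_congr hodd₂
    rw [Int.cast_one, mul_one] at e2
    have e4 : cexp (Real.pi * I - Real.pi * I * τ - 2 * Real.pi * I * v) =
        cexp (Real.pi * I * (d - b - b * d : ℤ)) *
          cexp (-(Real.pi * I * τ) - 2 * Real.pi * I * v) := by
      rw [e2, ← Complex.exp_add]; congr 1; ring
    have e3 : j⁻¹ * (c * τ + d) = 1 := by rw [← hjdef, inv_mul_cancel₀ hj]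
    simp only [hf]
    rw [e1, oddTheta_add_lattice, e4, ← mul_assoc, ← mul_assoc, ← Complex.exp_add,
      ← Complex.exp_add, ← Complex.exp_add]
    congr 2
    push_cast
    linear_combination (-(2 * Real.pi * I * v) - Real.pi * I * τ) * e3 + Real.pi * I * d * hτj
  have hf0 : f 0 = 0 := by simp [hf, oddTheta_zero]
  -- The chain-rule factor 1/j is the source of the weight; the derivative of the Gaussian is killed
  -- by θ_σ(0) = 0.
  have hder : HasDerivAt f (-(2 * Real.pi * I) * qPoch (nome σ) (nome σ) ^ 2 / j) 0 := by
    have h1 : HasDerivAt (fun u : ℂ ↦ oddTheta σ (u / j))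
        (-(2 * Real.pi * I) * qPoch (nome σ) (nome σ) ^ 2 * (1 / j)) 0 := by
      refine HasDerivAt.comp (h₂ := oddTheta σ) 0 ?_ ((hasDerivAt_id (0 : ℂ)).div_const j)
      simpa using hasDerivAt_oddTheta_zero σ
    have h2 : Differentiable ℂ fun u : ℂ ↦ cexp (-(Real.pi * I * c * u ^ 2 / j)) := by fun_prop
    refine ((h2 0).hasDerivAt.fun_mul h1).congr_deriv ?_
    simp [oddTheta_zero, div_eq_mul_inv]
  have hQ := qPoch_nome_ne_zero τ
  have key := eq_div_mul_of_quasiPeriodic τ hfd (differentiable_oddTheta τ)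
    (fun _ ↦ Complex.exp_ne_zero _) (fun _ ↦ Complex.exp_ne_zero _) hf₁ (oddTheta_add_one τ) hf₂
    (oddTheta_add_coe τ) (fun _ ↦ exists_of_oddTheta_eq_zero) hf0 (oddTheta_zero τ) hder
    (hasDerivAt_oddTheta_zero τ)
    (mul_ne_zero (neg_ne_zero.2 Complex.two_pi_I_ne_zero) (pow_ne_zero 2 hQ)) hu
  refine key.trans ?_
  have := Complex.two_pi_I_ne_zero
  congr 1
  rw [div_div, neg_mul, neg_mul, mul_neg, neg_div_neg_eq, mul_left_comm, mul_div_mul_left _ _ this]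

/-! ### From theta to `F1` and the multiplier -/

lemma zeta_zpow (p : ℕ) (l : ℤ) : zeta p ^ l = cexp (2 * Real.pi * I * (l / p)) := by
  rw [zeta, ← Complex.exp_int_mul]
  congr 1; ring

lemma E0_eq (p : ℕ) (l : ℤ) (τ : ℍ) :
    E0 p l τ = cexp (2 * Real.pi * I * τ / 12) *
      (cexp (Real.pi * I * (l / p)) * oddTheta τ (l / p)) := by
  have hq := norm_nome_lt_one τ
  have h : ∀ n : ℕ, (1 - zeta p ^ l * nome τ ^ n) * (1 - zeta p ^ (-l) * nome τ ^ (n + 1)) =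
      (1 - cexp (2 * Real.pi * I * (l / p)) * nome τ ^ n) *
        (1 - nome τ * cexp (-(2 * Real.pi * I * (l / p))) * nome τ ^ n) := by
    intro n
    rw [zpow_neg, zeta_zpow, ← Complex.exp_neg, pow_succ]
    ring
  rw [E0, tprod_congr h, (multipliable_qPoch hq _).tprod_mul (multipliable_qPoch hq _)]
  congr 1
  rw [oddTheta, ← mul_assoc, ← Complex.exp_add]
  simp [qPoch]

lemma eta_sq_eq (τ : ℍ) :
    ModularForm.eta τ ^ 2 =
      cexp (2 * Real.pi * I * τ / 12) * qPoch (nome τ) (nome τ) ^ 2 := by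
  have h : (fun n : ℕ ↦ 1 - ModularForm.eta_q n τ) = fun n : ℕ ↦ 1 - nome τ * nome τ ^ n := by
    ext n
    rw [ModularForm.eta_q_eq_pow, pow_succ', nome]
  rw [ModularForm.eta, h, mul_pow, ← qPoch, Function.Periodic.qParam, ← Complex.exp_nat_mul]
  congr 2
  push_cast; ring

lemma F1_eq (p : ℕ) (l : ℤ) (τ : ℍ) :
    F1 p l τ = qPoch (nome τ) (nome τ) ^ 2 /
      (cexp (Real.pi * I * (l / p)) * oddTheta τ (l / p)) := by
  rw [F1, E0_eq, eta_sq_eq, mul_div_mul_left _ _ (Complex.exp_ne_zero _)]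

lemma F1_emod {p : ℕ} (hp : p ≠ 0) (l : ℤ) : F1 p (l % p) = F1 p l := by
  have h : zeta p ^ (l % p : ℤ) = zeta p ^ l := by
    have h1 : zeta p ^ (p : ℤ) = 1 := by
      rw [zeta_zpow]
      have : (p : ℂ) ≠ 0 := by exact_mod_cast hp
      simp [this]
    conv_rhs => rw [← Int.emod_add_mul_ediv l p]
    rw [zpow_add₀ (by exact Complex.exp_ne_zero _), zpow_mul, h1, one_zpow, mul_one]
  ext τ
  simp only [F1, E0, zpow_neg, h]

lemma oddTheta_div_ne_zero {p : ℕ} (hp : p ≠ 0) {l : ℤ} (hl : ¬ (p : ℤ) ∣ l) (τ : ℍ) :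
    oddTheta τ (l / p) ≠ 0 := by
  intro h
  obtain ⟨m, n, hmn⟩ := exists_of_oddTheta_eq_zero h
  have hpc : (p : ℂ) ≠ 0 := by exact_mod_cast hp
  have him := congrArg Complex.im hmn
  have hl' : ((l : ℂ) / p) = (((l : ℝ) / p : ℝ) : ℂ) := by push_cast; rfl
  rw [hl', Complex.ofReal_im] at him
  have hm : m = 0 := by simpa [τ.im_pos.ne'] using him
  rw [hm, div_eq_iff hpc, Int.cast_zero, zero_mul, zero_add] at hmn
  exact hl ⟨n, by rw [mul_comm]; exact_mod_cast hmn⟩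

/-- Transformation of `F_1(ℓ; ·)` under `Γ₀(p)`. -/
lemma F1_slash {p : ℕ} (hp : p ≠ 0) {l : ℤ} {A : Matrix.SpecialLinearGroup (Fin 2) ℤ}
    (hA : (p : ℤ) ∣ A 1 0) (hl : ¬ (p : ℤ) ∣ A 1 1 * l) :
    F1 p l ∣[(1 : ℤ)] A = mu p A l • F1 p (A 1 1 * l) := by
  ext τ
  have hpc : (p : ℂ) ≠ 0 := by exact_mod_cast hp
  have hj : (A 1 0 * τ + A 1 1 : ℂ) ≠ 0 := by
    simpa [ModularGroup.denom_apply] using denom_ne_zero A τ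
  have hθ := oddTheta_div_ne_zero hp hl τ
  obtain ⟨c, hc⟩ := hA
  have hcC : (A 1 0 : ℂ) = p * c := by rw [hc]; push_cast; rfl
  -- Here c denotes the lower-left entry divided by p, so (ℓ/p)j = dℓ/p + cℓτ.
  have hlat := oddTheta_add_lattice τ ((A 1 1 * l : ℤ) / p) (c * l) 0
  have hu : ((A 1 1 * l : ℤ) / p + (((c * l : ℤ) : ℂ) * τ + (0 : ℤ)) : ℂ) =
      l / p * (A 1 0 * τ + A 1 1) := by
    rw [hcC]; field_simp; push_cast; ring
  rw [hu] at hlat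
  have hu0 : oddTheta τ (l / p * (A 1 0 * τ + A 1 1)) ≠ 0 := by
    rw [hlat]; exact mul_ne_zero (Complex.exp_ne_zero _) hθ
  have key := oddTheta_smul A τ hu0
  rw [hlat, mul_div_cancel_right₀ _ hj] at key
  have hQ := qPoch_nome_ne_zero τ
  have hQ' := qPoch_nome_ne_zero (A • τ)
  rw [ModularForm.SL_slash_apply, ModularGroup.denom_apply, Pi.smul_apply, smul_eq_mul, F1_eq,
    F1_eq, zpow_neg_one]
  have hθ' : oddTheta (A • τ) (l / p) ≠ 0 := by
    intro h0
    rw [h0, mul_zero] at key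
    refine mul_ne_zero (div_ne_zero (pow_ne_zero 2 hQ') (mul_ne_zero hj (pow_ne_zero 2 hQ)))
      (mul_ne_zero (Complex.exp_ne_zero _) hθ) key.symm
  -- The terms in τ from the Gaussian and from the quasi-period cancel; what remains is exactly the
  -- exponent of μ.
  have hexp : mu p A l * (cexp (Real.pi * I * (l / p)) *
      cexp (Real.pi * I * ((c * l : ℤ) + (0 : ℤ)) - Real.pi * I * (c * l : ℤ) ^ 2 * τ -
        2 * Real.pi * I * (c * l : ℤ) * ((A 1 1 * l : ℤ) / p))) =
      cexp (Real.pi * I * ((A 1 1 * l : ℤ) / p)) *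
        cexp (-(Real.pi * I * (A 1 0) * (l / p * (A 1 0 * τ + A 1 1)) ^ 2 /
          (A 1 0 * τ + A 1 1))) := by
    rw [mu, ← Complex.exp_add, ← Complex.exp_add, ← Complex.exp_add]
    congr 1
    rw [mul_pow, sq (_ + _ : ℂ), hcC] at *
    field_simp
    push_cast
    ring
  set e1 := cexp (Real.pi * I * ((c * l : ℤ) + (0 : ℤ)) - Real.pi * I * (c * l : ℤ) ^ 2 * τ -
        2 * Real.pi * I * (c * l : ℤ) * ((A 1 1 * l : ℤ) / p))
  set e2 := cexp (-(Real.pi * I * (A 1 0) * (l / p * (A 1 0 * τ + A 1 1)) ^ 2 /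
          (A 1 0 * τ + A 1 1)))
  have h1 := Complex.exp_ne_zero (Real.pi * I * (l / p))
  have h2 := Complex.exp_ne_zero (Real.pi * I * ((A 1 1 * l : ℤ) / p))
  have h3 : e2 ≠ 0 := Complex.exp_ne_zero _
  set s := oddTheta (A • τ) (l / p)
  set t := oddTheta τ ((A 1 1 * l : ℤ) / p)
  set Q := qPoch (nome τ) (nome τ)
  set Q' := qPoch (nome (A • τ)) (nome (A • τ))
  set j : ℂ := A 1 0 * τ + A 1 1
  set x := cexp (Real.pi * I * (l / p))
  set y := cexp (Real.pi * I * ((A 1 1 * l : ℤ) / p))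
  have key' : e2 * s * (j * Q ^ 2) = Q' ^ 2 * (e1 * t) := by
    rw [key]; field_simp
  rw [← div_eq_mul_inv, div_div, mul_div_assoc',
    div_eq_div_iff (mul_ne_zero (mul_ne_zero h1 hθ') hj) (mul_ne_zero h2 hθ)]
  refine mul_left_cancel₀ h3 ?_
  linear_combination (-(Q' ^ 2 * t)) * hexp - mu p A l * x * key'

lemma mu_eq_one {p : ℕ} (hp : p ≠ 0) (hodd : Odd p) (l : ℤ)
    {A : Matrix.SpecialLinearGroup (Fin 2) ℤ}
    (hc : (p : ℤ) ^ 2 ∣ A 1 0) (hd : (p : ℤ) ∣ A 1 1 - 1) : mu p A l = 1 := by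
  have hpc : (p : ℂ) ≠ 0 := by exact_mod_cast hp
  obtain ⟨c, hc⟩ := hc
  obtain ⟨k, hk⟩ := hd
  have hcC : (A 1 0 : ℂ) = p ^ 2 * c := by rw [hc]; push_cast; rfl
  have hkC : (A 1 1 : ℂ) = p * k + 1 := by
    rw [← sub_eq_iff_eq_add]; exact_mod_cast congrArg (Int.cast : ℤ → ℂ) hk
  have hdet : A 0 0 * A 1 1 - A 0 1 * A 1 0 = 1 := by
    rw [← Matrix.det_fin_two]; exact A.det_coe
  have hodd' : Odd (p : ℤ) := by exact_mod_cast hodd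
  -- With d = pk + 1 and p odd, this is ℓk(1 + c) modulo 2. If k is odd then d is even, and
  -- determinant 1 forces c to be odd.
  have heven : Even (l * k + c * (p * k + 1) * l ^ 2 - p * c * l - 0) := by
    have hpar : ¬ (Even (A 1 0) ∧ Even (A 1 1)) := by
      rintro ⟨⟨x, hx⟩, ⟨y, hy⟩⟩
      have : 2 * (A 0 0 * y - A 0 1 * x) = 1 := by
        rw [hx, hy] at hdet; linear_combination hdet
      omega
    rw [hc, sub_eq_iff_eq_add.1 hk] at hpar
    rw [← Int.not_even_iff_odd] at hodd'
    simp only [Int.even_sub, Int.even_add, Int.even_mul, Int.even_pow, Int.not_even_one,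
      Even.zero] at hpar ⊢
    tauto
  have h := exp_pi_mul_I_mul_int_congr heven
  rw [Int.cast_zero, mul_zero, Complex.exp_zero] at h
  rw [mu, hcC, hkC]
  refine Eq.trans ?_ h
  congr 2
  field_simp
  push_cast
  ring

end CrankForm

theorem theorem2p2 (p : ℕ) (hp : p.Prime) (hp3 : 3 < p)
    (l : ℤ) (hl1 : 1 ≤ l) (hlp : l ≤ (p : ℤ) - 1) :
    (∀ A : Matrix.SpecialLinearGroup (Fin 2) ℤ, A ∈ CongruenceSubgroup.Gamma0 p →
      (CrankForm.F1 p l) ∣[(1 : ℤ)] A =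
        CrankForm.mu p A l • CrankForm.F1 p ((A 1 1 * l) % (p : ℤ))) ∧
    (∀ A : Matrix.SpecialLinearGroup (Fin 2) ℤ,
      A ∈ CongruenceSubgroup.Gamma0 (p ^ 2) ⊓ CongruenceSubgroup.Gamma1 p →
      (CrankForm.F1 p l) ∣[(1 : ℤ)] A = CrankForm.F1 p l) := by
  have hp0 : p ≠ 0 := hp.ne_zero
  have hpl : ¬ (p : ℤ) ∣ l := fun h ↦ by
    have := Int.le_of_dvd (by omega) h
    omega
  have part1 : ∀ A : Matrix.SpecialLinearGroup (Fin 2) ℤ, A ∈ CongruenceSubgroup.Gamma0 p →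
      (CrankForm.F1 p l) ∣[(1 : ℤ)] A =
        CrankForm.mu p A l • CrankForm.F1 p ((A 1 1 * l) % (p : ℤ)) := by
    intro A hA
    rw [CongruenceSubgroup.Gamma0_mem, ZMod.intCast_zmod_eq_zero_iff_dvd] at hA
    rw [CrankForm.F1_emod hp0]
    refine CrankForm.F1_slash hp0 hA fun h ↦ ?_
    rcases (Nat.prime_iff_prime_int.1 hp).dvd_or_dvd h with h | h
    -- If p divided d as well as the lower-left entry, it would divide the determinant 1.
    · have hdet : A 0 0 * A 1 1 - A 0 1 * A 1 0 = 1 := by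
        rw [← Matrix.det_fin_two]; exact A.det_coe
      have h1 : (p : ℤ) ∣ 1 := hdet ▸ dvd_sub (h.mul_left _) (hA.mul_left _)
      exact (Nat.prime_iff_prime_int.1 hp).not_dvd_one h1
    · exact hpl h
  refine ⟨part1, fun A hA ↦ ?_⟩
  obtain ⟨hA0, hA1⟩ := Subgroup.mem_inf.1 hA
  rw [CongruenceSubgroup.Gamma0_mem, ZMod.intCast_zmod_eq_zero_iff_dvd, Nat.cast_pow] at hA0
  obtain ⟨-, hd, hc⟩ := (CongruenceSubgroup.Gamma1_mem p A).1 hA1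
  have hd' : (p : ℤ) ∣ A 1 1 - 1 := by
    rw [← ZMod.intCast_zmod_eq_zero_iff_dvd]
    push_cast
    rw [hd, sub_self]
  rw [part1 A (CongruenceSubgroup.Gamma0_mem.2 hc),
    CrankForm.mu_eq_one hp0 (hp.odd_of_ne_two (by omega)) l hA0 hd', one_smul]
  have hmod : (A 1 1 * l) % (p : ℤ) = l % p := by
    refine Int.ModEq.symm (Int.modEq_iff_dvd.2 ?_)
    rw [show A 1 1 * l - l = (A 1 1 - 1) * l by ring]
    exact hd'.mul_right l
  rw [hmod, CrankForm.F1_emod hp0]
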